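/- Let $d\in\{2,3\}$, let $\Omega\subset\mathbb R^d$ be a bounded Lipschitz domain, let $\mathcal T$ be a regular triangulation of $\Omega$ into simplices with set of faces $\mathcal F$ and $h=\max_{T\in\mathcal T}\operatorname{diam}T$, let $k\ge 1$ be an integer, and let $\nu,\alpha,c_M,M>0$. Write $(\cdot,\cdot)_\omega$ for the $L^2$ inner product on $\omega$, $(\cdot,\cdot)=(\cdot,\cdot)_\Omega$, $n$ for the outward unit normal on $\partial T$, $n_F$ for a unit normal of $F\in\mathcal F$, and $v_t=v-(v\cdot n)n$. Put $$V_h=[P_k(\mathcal T)]^d\cap H_0(\mathrm{div},\Omega),\qquad Q_h=P_{k-1}(\mathcal T),$$ $$\widehat V_h=\{\hat v_h\in [L^2(\mathcal F)]^d:\ \hat v_h|_F\in [P_k(F)]^d,\ \hat v_h\cdot n_F=0\ \ \forall F\in\mathcal F,\ \hat v_h=0\text{ on }\partial\Omega\},$$ where $H_0(\mathrm{div},\Omega)$ is the closure of $C_c^\infty(\Omega)^d$ in $H(\mathrm{div},\Omega)$ (equivalently, the fields with vanishing normal trace). For $g\in L^\infty(\Omega)^d$ and $f\in L^2(\Omega)^d$,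 the $H(\mathrm{div})$-conforming HDG scheme seeks $u_h\in V_h$, $\hat u_h\in\widehat V_h$, $\varrho_h\in Q_h$ such that, for all $v_h\in V_h$, $\hat v_h\in\widehat V_h$, $\lambda_h\in Q_h$, $$a_h((u_h,\hat u_h),(v_h,\hat v_h))-(c_M\varrho_h,\operatorname{div}v_h)=(f,v_h)+(g,\varrho_hv_h),\qquad c_h(\varrho_h,u_h,\lambda_h)=0,\qquad (\varrho_h,1)=M,$$ with $$a_h((u,\hat u),(v,\hat v))=\nu\sum_{T\in\mathcal T}\Big[(\nabla u,\nabla v)_T+(\nabla u\,n,(\hat v-v)_t)_{\partial T}+(\nabla v\,n,(\hat u-u)_t)_{\partial T}+\tfrac{\alpha k^2}{h}((\hat u-u)_t,(\hat v-v)_t)_{\partial T}\Big],$$ $$c_h(\varrho,u,\lambda)=\sum_{T\in\mathcal T}\Big[-(\varrho u,\nabla\lambda)_T+(u\cdot n\,\varrho^{up},\lambda)_{\partial T}\Big],$$ where $\varrho^{up}$ is the upwind value: on a face of $T$ it is the trace of $\varrho$ from $T$ where $u\cdot n\ge 0$ and the trace from the neighboring element where $u\cdot n<0$. A force $f\in L^2(\Omega)^d$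 is an admissible gradient force if $f=\nabla q$ (weakly) for some $q\in H^1(\Omega)$ for which there is a constant $C$ with $(q-C)/c_M\ge 0$ a.e. in $\Omega$ and $((q-C)/c_M,1)=M$. The scheme is gradient-robust if, whenever $g=0$ and $f$ is an admissible gradient force, it has a solution with $u_h=0$ and $\hat u_h=0$. Then the scheme is gradient-robust. More precisely, if $g=0$ and $f=\nabla q$ is an admissible gradient force with potential $q$, then $$u_h=0,\qquad \hat u_h=0,\qquad \varrho_h=\frac{1}{c_M}\Pi_{Q_h}q+\kappa,\qquad \kappa=\frac{1}{|\Omega|}\Big(M-\frac1{c_M}\int_\Omega q\,dx\Big),$$ solves the scheme, where $\Pi_{Q_h}$ is the $L^2(\Omega)$-orthogonal projection onto $Q_h$. If $k=1$, then moreover $\varrho_h\ge 0$, and $\varrho_h>0$ if $q/c_M+\kappa>0$ a.e. in $\Omega$. -/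

import Mathlib

open MeasureTheory Filter Topology
open scoped ContDiff ENNReal

noncomputable section

namespace CompressibleStokes

/-- The space `ℝ^d` with its Euclidean norm. -/
abbrev Rd (d : ℕ) : Type := EuclideanSpace ℝ (Fin d)

variable {d : ℕ}

/-! ### Lipschitz domains -/

/-- A bounded Lipschitz domain: nonempty, open, connected, bounded, and near each boundary point,
in suitable orthonormal coordinates (with "vertical" direction `e`), the set of points strictly
above the graph of a Lipschitz function of the remaining `d - 1` coordinates. -/
structure IsLipschitzDomain (Ω : Set (Rd d)) : Prop where
  isOpen : IsOpen Ω
  isConnected : IsConnected Ω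
  isBounded : Bornology.IsBounded Ω
  lipschitz_boundary : ∀ x₀ ∈ frontier Ω, ∃ e : Rd d, ‖e‖ = 1 ∧
    ∃ (L : NNReal) (γ : (Submodule.span ℝ {e})ᗮ → ℝ), LipschitzWith L γ ∧
      ∃ U ∈ 𝓝 x₀, ∀ x ∈ U,
        (x ∈ Ω ↔ γ ((Submodule.span ℝ {e})ᗮ.orthogonalProjectionOnto x) < inner ℝ e x)

/-! ### Weak derivatives, `H¹(Ω)` and `H₀(div, Ω)` -/

/-- Lebesgue measure on `Ω`. -/
abbrev vol (Ω : Set (Rd d)) : Measure (Rd d) := volume.restrict Ω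

/-- `C_c^∞(Ω; G)`. -/
structure IsTestFunction {G : Type*} [NormedAddCommGroup G] [NormedSpace ℝ G]
    (Ω : Set (Rd d)) (φ : Rd d → G) : Prop where
  smooth : ContDiff ℝ ∞ φ
  compact : HasCompactSupport φ
  support_subset : tsupport φ ⊆ Ω

/-- The classical partial derivative `∂_i φ`. -/
def partialDeriv (i : Fin d) (φ : Rd d → ℝ) (x : Rd d) : ℝ :=
  fderiv ℝ φ x (EuclideanSpace.single i 1)

/-- The classical divergence of a vector field. -/
def classicalDiv (φ : Rd d → Rd d) (x : Rd d) : ℝ :=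
  ∑ i, partialDeriv i (fun y => φ y i) x

/-- `q ∈ H¹(Ω)` with weak gradient `f`. -/
structure IsH1WithGradient (Ω : Set (Rd d)) (q : Rd d → ℝ) (f : Rd d → Rd d) : Prop where
  memLp : MemLp q 2 (vol Ω)
  memLp_gradient : MemLp f 2 (vol Ω)
  weak : ∀ φ : Rd d → ℝ, IsTestFunction Ω φ → ∀ i,
    ∫ x in Ω, q x * partialDeriv i φ x = -∫ x in Ω, f x i * φ x

/-- `w ∈ L²(Ω)` is the weak divergence of `v` on `Ω`. -/
structure HasWeakDiv (Ω : Set (Rd d)) (v : Rd d → Rd d) (w : Rd d → ℝ) : Prop where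
  memLp : MemLp w 2 (vol Ω)
  weak : ∀ φ : Rd d → ℝ, IsTestFunction Ω φ →
    ∫ x in Ω, w x * φ x = -∫ x in Ω, ∑ i, v x i * partialDeriv i φ x

/-- `v ∈ H(div, Ω)`. -/
def MemHdiv (Ω : Set (Rd d)) (v : Rd d → Rd d) : Prop :=
  MemLp v 2 (vol Ω) ∧ ∃ w, HasWeakDiv Ω v w

open Classical in
/-- The weak divergence of `v ∈ H(div, Ω)`, an element of `L²(Ω)` (unique up to null sets). -/
def weakDiv (Ω : Set (Rd d)) (v : Rd d → Rd d) : Rd d → ℝ :=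
  if h : ∃ w, HasWeakDiv Ω v w then h.choose else 0

/-- `v ∈ H₀(div, Ω)`: the closure of `C_c^∞(Ω)^d` in `H(div, Ω)`. On a Lipschitz domain these are
the fields in `H(div, Ω)` with vanishing normal trace. -/
def MemH0div (Ω : Set (Rd d)) (v : Rd d → Rd d) : Prop :=
  MemHdiv Ω v ∧ ∃ φ : ℕ → Rd d → Rd d, (∀ n, IsTestFunction Ω (φ n)) ∧
    Tendsto (fun n => eLpNorm (fun x => v x - φ n x) 2 (vol Ω)) atTop (𝓝 0) ∧
    Tendsto (fun n => eLpNorm (fun x => weakDiv Ω v x - classicalDiv (φ n) x) 2 (vol Ω))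
      atTop (𝓝 0)

/-! ### Triangulations -/

/-- A regular (conforming) triangulation of `Ω` into `d`-simplices: a finite geometric simplicial
complex, all of whose simplices are faces of `d`-simplices, that covers the closure of `Ω`. -/
structure Triangulation (Ω : Set (Rd d)) where
  complex : Geometry.SimplicialComplex ℝ (Rd d)
  finite : complex.faces.Finite
  pure : ∀ s ∈ complex.faces, ∃ t ∈ complex.faces, s ⊆ t ∧ t.card = d + 1
  space_eq : complex.space = closure Ω

/-- The closed simplex with the given vertices. -/
abbrev hull (s : Finset (Rd d)) : Set (Rd d) := convexHull ℝ (s : Set (Rd d))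

namespace Triangulation

variable {Ω : Set (Rd d)} (𝒯 : Triangulation Ω)

/-- The elements `T` of the triangulation, as vertex sets. -/
def cells : Finset (Finset (Rd d)) := {s ∈ 𝒯.finite.toFinset | s.card = d + 1}

/-- The `(d-1)`-dimensional faces `F` of the triangulation, as vertex sets. -/
def facets : Finset (Finset (Rd d)) := {s ∈ 𝒯.finite.toFinset | s.card = d}

/-- The mesh size `h = max_T diam T`. -/
def meshSize : ℝ := ⨆ T : 𝒯.cells, Metric.diam (hull T.1)

open Classical in
/-- `∫_{∂T} φ ds`, as the sum over the faces `F` of `T` of the surface integrals over `F` of the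
values `φ F` on `F`. -/
def bdryIntegral (T : 𝒯.cells) (φ : 𝒯.facets → Rd d → ℝ) : ℝ :=
  ∑ F : 𝒯.facets with F.1 ⊆ T.1, ∫ x in hull F.1, φ F x ∂(Measure.euclideanHausdorffMeasure (d - 1))

end Triangulation

/-- `n` is a unit normal vector of the face `F`. -/
def IsUnitNormal (F : Finset (Rd d)) (n : Rd d) : Prop :=
  ‖n‖ = 1 ∧ ∀ x ∈ F, ∀ y ∈ F, inner ℝ n (x - y) = 0

/-- The unit normal vector on the face `F` of the simplex `T` that points out of `T`. -/
def outwardNormal (T F : Finset (Rd d)) : Rd d :=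
  Classical.epsilon fun n => IsUnitNormal F n ∧ ∀ x ∈ T, ∀ y ∈ F, inner ℝ n (x - y) ≤ 0

/-- The tangential part `v_t = v - (v · n) n`. -/
def tangential (n v : Rd d) : Rd d := v - (inner ℝ v n : ℝ) • n

/-! ### Piecewise polynomials -/

/-- Real polynomials in `d` variables. -/
abbrev Poly (d : ℕ) : Type := MvPolynomial (Fin d) ℝ

/-- The value of a scalar polynomial at a point. -/
def pval (p : Poly d) (x : Rd d) : ℝ := MvPolynomial.eval (fun i => x i) p

/-- The value of a vector-valued polynomial at a point. -/
def vval (v : Fin d → Poly d) (x : Rd d) : Rd d := WithLp.toLp 2 fun i => pval (v i) x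

/-- The gradient of a scalar polynomial. -/
def pgrad (p : Poly d) (x : Rd d) : Rd d := WithLp.toLp 2 fun j => pval (MvPolynomial.pderiv j p) x

/-- The matrix product `(∇v) n`, where `(∇v)_{ij} = ∂_j v_i`. -/
def gradMul (v : Fin d → Poly d) (n x : Rd d) : Rd d :=
  WithLp.toLp 2 fun i => ∑ j, pval (MvPolynomial.pderiv j (v i)) x * n j

/-- The Frobenius product `∇u : ∇v`. -/
def gradInner (u v : Fin d → Poly d) (x : Rd d) : ℝ :=
  ∑ i, ∑ j, pval (MvPolynomial.pderiv j (u i)) x * pval (MvPolynomial.pderiv j (v i)) x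

namespace Triangulation

variable {Ω : Set (Rd d)} (𝒯 : Triangulation Ω)

/-- A scalar piecewise polynomial: one polynomial on each element (so that `λ T` is both the
restriction to `T` and gives the trace from `T` on `∂T`). -/
abbrev Scalar : Type := 𝒯.cells → Poly d

/-- A vector-valued piecewise polynomial. -/
abbrev Vector : Type := 𝒯.cells → Fin d → Poly d

/-- A vector-valued function on the skeleton that is polynomial on each face; only the values of
the polynomial `v F` on `F` are ever used. -/
abbrev FacetVector : Type := 𝒯.facets → Fin d → Poly d

variable {𝒯}

/-- The function on `Ω` (defined up to the skeleton, a null set) given by a piecewise polynomial. -/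
def Scalar.toFun (r : 𝒯.Scalar) (x : Rd d) : ℝ :=
  ∑ T, (interior (hull T.1)).indicator (pval (r T)) x

/-- The vector field on `Ω` (defined up to a null set) given by a piecewise polynomial. -/
def Vector.toFun (v : 𝒯.Vector) (x : Rd d) : Rd d :=
  ∑ T, (interior (hull T.1)).indicator (vval (v T)) x

variable (𝒯)

/-- The space `P_m(𝒯)` of piecewise polynomials of total degree at most `m`. -/
def scalarSpace (m : ℕ) : Set 𝒯.Scalar := {r | ∀ T, (r T).totalDegree ≤ m}

/-- The density and pressure space `Q_h = P_{k-1}(𝒯)`. -/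
def Qh (k : ℕ) : Set 𝒯.Scalar := 𝒯.scalarSpace (k - 1)

/-- The velocity space `V_h = P_k(𝒯)^d ∩ H₀(div, Ω)`. -/
def Vh (k : ℕ) : Set 𝒯.Vector :=
  {v | (∀ T i, (v T i).totalDegree ≤ k) ∧ MemH0div Ω (Vector.toFun v)}

/-- The hybrid space: polynomials of degree at most `k` on each face, tangential to it, and zero
on the faces in the boundary of `Ω`. -/
def VhHat (k : ℕ) : Set 𝒯.FacetVector :=
  {v | (∀ F i, (v F i).totalDegree ≤ k) ∧
    (∀ F, ∀ n, IsUnitNormal F.1 n → ∀ x ∈ hull F.1, inner ℝ (vval (v F) x) n = 0) ∧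
    (∀ F, hull F.1 ⊆ frontier Ω → ∀ x ∈ hull F.1, vval (v F) x = 0)}

/-- `π` is the `L²(Ω)`-orthogonal projection of `q` onto `Q_h`. -/
def IsL2Projection (k : ℕ) (q : Rd d → ℝ) (π : 𝒯.Scalar) : Prop :=
  π ∈ 𝒯.Qh k ∧ ∀ r ∈ 𝒯.Qh k, ∫ x in Ω, (q x - Scalar.toFun π x) * Scalar.toFun r x = 0

/-! ### The forms of the scheme -/

/-- `(û - u)_t`: the tangential part of `û - u` on the face `F` of `T`. -/
def tangJump (u : 𝒯.Vector) (uhat : 𝒯.FacetVector) (T : 𝒯.cells) (F : 𝒯.facets) (x : Rd d) : Rd d :=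
  tangential (outwardNormal T.1 F.1) (vval (uhat F) x - vval (u T) x)

/-- The diffusion form `a_h((u, û), (v, v̂))`. -/
def aForm (k : ℕ) (ν α : ℝ) (u : 𝒯.Vector) (uhat : 𝒯.FacetVector)
    (v : 𝒯.Vector) (vhat : 𝒯.FacetVector) : ℝ :=
  ν * ∑ T : 𝒯.cells,
    ((∫ x in hull T.1, gradInner (u T) (v T) x)
      + 𝒯.bdryIntegral T (fun F x =>
          inner ℝ (gradMul (u T) (outwardNormal T.1 F.1) x) (𝒯.tangJump v vhat T F x))
      + 𝒯.bdryIntegral T (fun F x =>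
          inner ℝ (gradMul (v T) (outwardNormal T.1 F.1) x) (𝒯.tangJump u uhat T F x))
      + α * (k : ℝ) ^ 2 / 𝒯.meshSize * 𝒯.bdryIntegral T (fun F x =>
          inner ℝ (𝒯.tangJump u uhat T F x) (𝒯.tangJump v vhat T F x)))

/-- The pressure form `-(p(ϱ), div v)` for the equation of state `p(ϱ) = c_M ϱ`. -/
def bForm (cM : ℝ) (r : 𝒯.Scalar) (v : 𝒯.Vector) : ℝ :=
  -∫ x in Ω, (cM * Scalar.toFun r x) * weakDiv Ω (Vector.toFun v) x

open Classical in
/-- The upwind value of `ϱ` on the face `F` of `T`: the value from `T` where the flow leaves `T`,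
and the value from the neighbor of `T` across `F` (the only other element that contains `F`) where
it enters `T`. On boundary faces the normal velocity vanishes and the value is irrelevant. -/
def upwind (r : 𝒯.Scalar) (u : 𝒯.Vector) (T : 𝒯.cells) (F : 𝒯.facets) (x : Rd d) : ℝ :=
  if 0 ≤ (inner ℝ (vval (u T) x) (outwardNormal T.1 F.1) : ℝ) then pval (r T) x
  else ∑ T' : 𝒯.cells with T' ≠ T ∧ F.1 ⊆ T'.1, pval (r T') x

/-- The transport form `c_h(ϱ, u, λ)`. -/
def cForm (r : 𝒯.Scalar) (u : 𝒯.Vector) (l : 𝒯.Scalar) : ℝ :=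
  ∑ T : 𝒯.cells,
    (-(∫ x in hull T.1, pval (r T) x * inner ℝ (vval (u T) x) (pgrad (l T) x))
      + 𝒯.bdryIntegral T (fun F x =>
          inner ℝ (vval (u T) x) (outwardNormal T.1 F.1) * 𝒯.upwind r u T F x * pval (l T) x))

/-- The force term `F_h(v) = (f, v)`. -/
def fForm (f : Rd d → Rd d) (v : 𝒯.Vector) : ℝ :=
  ∫ x in Ω, inner ℝ (f x) (Vector.toFun v x)

/-- The gravity term `G_h(ϱ, v) = (g, ϱ v)`. -/
def gForm (g : Rd d → Rd d) (r : 𝒯.Scalar) (v : 𝒯.Vector) : ℝ :=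
  ∫ x in Ω, inner ℝ (g x) (Scalar.toFun r x • Vector.toFun v x)

/-- `(u, û, ϱ)` solves the `H(div)`-conforming HDG scheme with data `g`, `f` and mass `M`. -/
structure IsDiscreteSolution (k : ℕ) (ν α cM M : ℝ) (g f : Rd d → Rd d)
    (u : 𝒯.Vector) (uhat : 𝒯.FacetVector) (r : 𝒯.Scalar) : Prop where
  velocity_mem : u ∈ 𝒯.Vh k
  hybrid_mem : uhat ∈ 𝒯.VhHat k
  density_mem : r ∈ 𝒯.Qh k
  momentum : ∀ v ∈ 𝒯.Vh k, ∀ vhat ∈ 𝒯.VhHat k,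
    𝒯.aForm k ν α u uhat v vhat + 𝒯.bForm cM r v = 𝒯.fForm f v + 𝒯.gForm g r v
  continuity : ∀ l ∈ 𝒯.Qh k, 𝒯.cForm r u l = 0
  mass : ∫ x in Ω, Scalar.toFun r x = M

end Triangulation

/-! ### Gradient-robustness -/

/-- The potential `q` is admissible: for some constant `C` the density `(q - C) / c_M` is
non-negative and has mass `M`. -/
def IsAdmissiblePotential (Ω : Set (Rd d)) (cM M : ℝ) (q : Rd d → ℝ) : Prop :=
  ∃ C : ℝ, (∀ᵐ x ∂(vol Ω), 0 ≤ (q x - C) / cM) ∧ ∫ x in Ω, (q x - C) / cM = M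

/-- `f` is an admissible gradient force. -/
def IsAdmissibleGradientForce (Ω : Set (Rd d)) (cM M : ℝ) (f : Rd d → Rd d) : Prop :=
  ∃ q, IsH1WithGradient Ω q f ∧ IsAdmissiblePotential Ω cM M q

/-- The scheme is gradient-robust: it has a hydrostatic solution (vanishing velocity) whenever
`g = 0` and `f` is an admissible gradient force. -/
def Triangulation.GradientRobust {Ω : Set (Rd d)} (𝒯 : Triangulation Ω) (k : ℕ)
    (ν α cM M : ℝ) : Prop :=
  ∀ f : Rd d → Rd d, IsAdmissibleGradientForce Ω cM M f →
    ∃ r : 𝒯.Scalar, 𝒯.IsDiscreteSolution k ν α cM M 0 f 0 0 r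

/-- The piecewise polynomial `π / c_M + κ`. -/
def Triangulation.hydrostaticDensity {Ω : Set (Rd d)} {𝒯 : Triangulation Ω} (cM κ : ℝ)
    (π : 𝒯.Scalar) : 𝒯.Scalar :=
  fun T => MvPolynomial.C cM⁻¹ * π T + MvPolynomial.C κ

end CompressibleStokes

end

/-!
With `u = 0` and `û = 0` only the balance `-(c_M ϱ, div v) = (f, v)` is left of the scheme. Since
`div V_h ⊆ Q_h`, testing `c_M ϱ = Π_{Q_h} q + c_M κ` with `div v` is the same as testing
`q + c_M κ`; the constant drops out and integration by parts in `H₀(div, Ω)` gives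
`-(q, div v) = (∇q, v)`. For `k = 1` the projection is the mean value on each element, so that the
sign of `q / c_M + κ` is inherited by the density.

The weak divergence of `v ∈ V_h` is the piecewise one because weak divergences restrict to open
subsets: the interiors of the elements, intersected with `Ω`, are nonempty, open, pairwise disjoint
and exhaust `Ω` up to a null set, and `v` is smooth on each of them.
-/

namespace CompressibleStokes

/-! ### Square-integrable functions -/

section L2

variable {X ι 𝕜 E : Type*} [MeasurableSpace X] [RCLike 𝕜] [NormedAddCommGroup E]
  [InnerProductSpace 𝕜 E] {μ : Measure X}

theorem inner_toLp_toLp {f g : X → E} (hf : MemLp f 2 μ) (hg : MemLp g 2 μ) :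
    inner 𝕜 (hf.toLp f) (hg.toLp g) = ∫ x, inner 𝕜 (f x) (g x) ∂μ := by
  rw [L2.inner_def]
  refine integral_congr_ae ?_
  filter_upwards [hf.coeFn_toLp, hg.coeFn_toLp] with x hfx hgx
  rw [hfx, hgx]

theorem tendsto_integral_inner_of_tendsto_eLpNorm {l : Filter ι} {f g : X → E} {φ : ι → X → E}
    (hf : MemLp f 2 μ) (hg : MemLp g 2 μ) (hφ : ∀ n, MemLp (φ n) 2 μ)
    (h : Tendsto (fun n => eLpNorm (fun x => g x - φ n x) 2 μ) l (𝓝 0)) :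
    Tendsto (fun n => ∫ x, inner 𝕜 (f x) (φ n x) ∂μ) l (𝓝 (∫ x, inner 𝕜 (f x) (g x) ∂μ)) := by
  have hlim : Tendsto (fun n => (hφ n).toLp (φ n)) l (𝓝 (hg.toLp g)) := by
    rw [Lp.tendsto_Lp_iff_tendsto_eLpNorm'']
    exact h.congr fun n => eLpNorm_sub_comm g (φ n) 2 μ
  simpa only [inner_toLp_toLp] using (tendsto_const_nhds (x := hf.toLp f)).inner (𝕜 := 𝕜) hlim

theorem exists_forall_integral_inner_sub_eq_zero {V : Type*} [AddCommGroup V] [Module 𝕜 V]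
    [FiniteDimensional 𝕜 V] (Φ : V →ₗ[𝕜] X → E) (hΦ : ∀ v, MemLp (Φ v) 2 μ) {q : X → E}
    (hq : MemLp q 2 μ) : ∃ v, ∀ w, ∫ x, inner 𝕜 (q x - Φ v x) (Φ w x) ∂μ = 0 := by
  let Ψ : V →ₗ[𝕜] Lp E 2 μ :=
    { toFun := fun v => (hΦ v).toLp (Φ v)
      map_add' := fun v w => by simp only [map_add]; exact MemLp.toLp_add _ _
      map_smul' := fun c v => by simp only [map_smul]; exact MemLp.toLp_const_smul c _ }
  obtain ⟨_, ⟨v, rfl⟩, hv⟩ :=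
    Submodule.HasOrthogonalProjection.exists_orthogonal (K := LinearMap.range Ψ) (hq.toLp q)
  refine ⟨v, fun w => ?_⟩
  have hvw : inner 𝕜 ((hq.sub (hΦ v)).toLp (q - Φ v)) ((hΦ w).toLp (Φ w)) = 0 :=
    (Submodule.mem_orthogonal' _ _).1 hv (Ψ w) ⟨w, rfl⟩
  simpa only [inner_toLp_toLp, Pi.sub_apply] using hvw

end L2

theorem average_div_add_const {X : Type*} [MeasurableSpace X] {μ : Measure X} [IsFiniteMeasure μ]
    [NeZero μ] {g : X → ℝ} (hg : Integrable g μ) (a b : ℝ) :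
    ⨍ x, (g x / a + b) ∂μ = (⨍ x, g x ∂μ) / a + b := by
  rw [average, integral_add (hg.to_average.div_const a) (integrable_const b), integral_div,
    integral_const, probReal_univ, one_smul, average]

variable {d : ℕ}

/-! ### Polynomials -/

theorem totalDegree_pderiv_le {σ R : Type*} [CommSemiring R] (i : σ) (p : MvPolynomial σ R) :
    (MvPolynomial.pderiv i p).totalDegree ≤ p.totalDegree - 1 := by
  rw [p.as_sum, map_sum, ← p.as_sum]
  refine MvPolynomial.totalDegree_finsetSum_le fun s hs => ?_
  rw [MvPolynomial.pderiv_monomial]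
  by_cases hsi : s i = 0
  · simp [hsi]
  refine (MvPolynomial.totalDegree_monomial_le _ _).trans ?_
  have hle : Finsupp.single i 1 ≤ s :=
    Finsupp.single_le_iff.2 (Nat.one_le_iff_ne_zero.2 hsi)
  have hdeg : (s - Finsupp.single i 1).degree + 1 = s.degree := by
    conv_rhs => rw [← tsub_add_cancel_of_le hle]
    simp
  have hs_le : s.degree ≤ p.totalDegree := MvPolynomial.le_totalDegree hs
  change (s - Finsupp.single i 1).degree ≤ _
  omega

theorem contDiff_pval {n : WithTop ℕ∞} (p : Poly d) : ContDiff ℝ n (pval p) :=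
  (AnalyticOnNhd.eval_continuousLinearMap' (𝕜 := ℝ)
    (fun i => (EuclideanSpace.proj i : Rd d →L[ℝ] ℝ)) p).contDiff

theorem contDiff_vval {n : WithTop ℕ∞} (v : Fin d → Poly d) : ContDiff ℝ n (vval v) :=
  contDiff_euclidean.2 fun i => contDiff_pval (v i)

theorem hasFDerivAt_pval (p : Poly d) (x : Rd d) :
    HasFDerivAt (pval p)
      (∑ i, pval (MvPolynomial.pderiv i p) x • (EuclideanSpace.proj i : Rd d →L[ℝ] ℝ)) x := by
  induction p using MvPolynomial.induction_on with
  | C a =>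
    have hC : pval (MvPolynomial.C a : Poly d) = fun _ => a := by ext y; simp [pval]
    simpa [hC, pval] using hasFDerivAt_const a x
  | add p q hp hq =>
    have hadd : pval (p + q) = fun y => pval p y + pval q y := by ext y; simp [pval]
    rw [hadd]
    refine (hp.add hq).congr_fderiv ?_
    simp [pval, add_smul, Finset.sum_add_distrib]
  | mul_X p j hp =>
    have hmul : pval (p * MvPolynomial.X j) = fun y => pval p y * y j := by ext y; simp [pval]
    rw [hmul]
    refine (hp.mul (EuclideanSpace.proj j : Rd d →L[ℝ] ℝ).hasFDerivAt).congr_fderiv ?_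
    simp [pval, MvPolynomial.pderiv_X, Pi.single_apply, add_smul, Finset.sum_add_distrib,
      Finset.smul_sum, smul_smul, apply_ite, ite_smul, Finset.sum_ite_eq]

theorem partialDeriv_pval (i : Fin d) (p : Poly d) (x : Rd d) :
    partialDeriv i (pval p) x = pval (MvPolynomial.pderiv i p) x := by
  simp [partialDeriv, (hasFDerivAt_pval p x).fderiv]

theorem classicalDiv_vval (v : Fin d → Poly d) (x : Rd d) :
    classicalDiv (vval v) x = pval (∑ i, MvPolynomial.pderiv i (v i)) x := by
  have hcomp (i : Fin d) : (fun y => vval v y i) = pval (v i) := rfl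
  simp only [classicalDiv, hcomp, partialDeriv_pval]
  simp only [pval, map_sum]

theorem vval_zero : vval (0 : Fin d → Poly d) = 0 := by
  ext x i
  simp [vval, pval]

/-! ### Test functions -/

theorem continuous_partialDeriv {ψ : Rd d → ℝ} (hψ : ContDiff ℝ 1 ψ) (i : Fin d) :
    Continuous (partialDeriv i ψ) :=
  (hψ.continuous_fderiv one_ne_zero).clm_apply continuous_const

namespace IsTestFunction

section Basic

variable {G : Type*} [NormedAddCommGroup G] [NormedSpace ℝ G] {U Ω : Set (Rd d)} {φ : Rd d → G}

theorem zero (Ω : Set (Rd d)) : IsTestFunction Ω (0 : Rd d → G) where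
  smooth := contDiff_const
  compact := HasCompactSupport.zero
  support_subset := by simp

theorem memLp (hφ : IsTestFunction Ω φ) (p : ℝ≥0∞) : MemLp φ p (vol Ω) :=
  (hφ.smooth.continuous.memLp_of_hasCompactSupport hφ.compact).restrict _

theorem mono (hφ : IsTestFunction U φ) (hU : U ⊆ Ω) : IsTestFunction Ω φ :=
  ⟨hφ.smooth, hφ.compact, hφ.support_subset.trans hU⟩

theorem setIntegral_eq_integral (hφ : IsTestFunction Ω φ) {g : Rd d → ℝ}
    (hg : ∀ x ∉ tsupport φ, g x = 0) : ∫ x in Ω, g x = ∫ x, g x :=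
  setIntegral_eq_integral_of_forall_compl_eq_zero fun x hx =>
    hg x fun hxφ => hx (hφ.support_subset hxφ)

end Basic

variable {Ω : Set (Rd d)} {φ : Rd d → ℝ}

theorem partialDeriv (hφ : IsTestFunction Ω φ) (i : Fin d) :
    IsTestFunction Ω (partialDeriv i φ) where
  smooth := ContDiff.clm_apply (hφ.smooth.fderiv_right (by simp)) contDiff_const
  compact := hφ.compact.fderiv_apply ℝ _
  support_subset := (tsupport_fderiv_apply_subset ℝ _).trans hφ.support_subset

theorem partialDeriv_eq_zero_of_notMem {x : Rd d} (hx : x ∉ tsupport φ) (i : Fin d) :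
    CompressibleStokes.partialDeriv i φ x = 0 :=
  image_eq_zero_of_notMem_tsupport fun hx' => hx (tsupport_fderiv_apply_subset ℝ _ hx')

theorem integrable_mul (hφ : IsTestFunction Ω φ) {g : Rd d → ℝ} (hg : Continuous g) :
    Integrable (fun x => g x * φ x) :=
  (hg.mul hφ.smooth.continuous).integrable_of_hasCompactSupport hφ.compact.mul_left

theorem setIntegral_mul_partialDeriv (hφ : IsTestFunction Ω φ) {ψ : Rd d → ℝ}
    (hψ : ContDiff ℝ 1 ψ) (i : Fin d) :
    ∫ x in Ω, ψ x * CompressibleStokes.partialDeriv i φ x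
      = -∫ x in Ω, CompressibleStokes.partialDeriv i ψ x * φ x := by
  rw [hφ.setIntegral_eq_integral fun x hx => by rw [partialDeriv_eq_zero_of_notMem hx, mul_zero],
    hφ.setIntegral_eq_integral fun x hx => by rw [image_eq_zero_of_notMem_tsupport hx, mul_zero]]
  exact integral_mul_fderiv_eq_neg_fderiv_mul_of_integrable
    (hφ.integrable_mul (continuous_partialDeriv hψ i))
    ((hφ.partialDeriv i).integrable_mul hψ.continuous) (hφ.integrable_mul hψ.continuous)
    (fun x _ => hψ.differentiable one_ne_zero x)
    (fun x _ => hφ.smooth.differentiable (by simp) x)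

theorem component {φ : Rd d → Rd d} (hφ : IsTestFunction Ω φ) (i : Fin d) :
    IsTestFunction Ω (fun x => φ x i) where
  smooth := contDiff_euclidean.1 hφ.smooth i
  compact := hφ.compact.comp_left (g := fun y : Rd d => y i) rfl
  support_subset := (tsupport_comp_subset (g := fun y : Rd d => y i) rfl φ).trans hφ.support_subset

theorem memLp_classicalDiv {φ : Rd d → Rd d} (hφ : IsTestFunction Ω φ) (p : ℝ≥0∞) :
    MemLp (classicalDiv φ) p (vol Ω) :=
  memLp_finsetSum _ fun i _ => ((hφ.component i).partialDeriv i).memLp p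

end IsTestFunction

/-! ### Weak gradients and weak divergences -/

section Weak

variable {U Ω : Set (Rd d)} {q : Rd d → ℝ} {f v v' : Rd d → Rd d} {w w' : Rd d → ℝ}

theorem isH1WithGradient_const [IsFiniteMeasure (vol Ω)] (c : ℝ) :
    IsH1WithGradient Ω (fun _ => c) 0 where
  memLp := memLp_const c
  memLp_gradient := MemLp.zero
  weak φ hφ i := by
    simpa [partialDeriv] using hφ.setIntegral_mul_partialDeriv (contDiff_const (c := c)) i

theorem IsH1WithGradient.setIntegral_inner_of_isTestFunction {φ : Rd d → Rd d}
    (hq : IsH1WithGradient Ω q f) (hφ : IsTestFunction Ω φ) :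
    ∫ x in Ω, inner ℝ (f x) (φ x) = -∫ x in Ω, q x * classicalDiv φ x := by
  have hf (i : Fin d) : MemLp (fun x => f x i) 2 (vol Ω) :=
    (EuclideanSpace.proj i : Rd d →L[ℝ] ℝ).comp_memLp' hq.memLp_gradient
  have hqφ (i : Fin d) : Integrable (fun x => q x * partialDeriv i (fun y => φ y i) x) (vol Ω) :=
    hq.memLp.integrable_mul (((hφ.component i).partialDeriv i).memLp 2)
  have hfφ (i : Fin d) : Integrable (fun x => f x i * φ x i) (vol Ω) :=
    (hf i).integrable_mul ((hφ.component i).memLp 2)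
  calc ∫ x in Ω, inner ℝ (f x) (φ x)
      = ∑ i, ∫ x in Ω, f x i * φ x i := by
        simp only [PiLp.inner_apply, RCLike.inner_apply, conj_trivial, mul_comm (φ _ _)]
        exact integral_finsetSum _ fun i _ => hfφ i
    _ = -∑ i, ∫ x in Ω, q x * partialDeriv i (fun y => φ y i) x := by
        simp only [hq.weak _ (hφ.component _), Finset.sum_neg_distrib, neg_neg]
    _ = -∫ x in Ω, q x * classicalDiv φ x := by
        simp only [classicalDiv, Finset.mul_sum]
        rw [integral_finsetSum _ fun i _ => hqφ i]

theorem hasWeakDiv_classicalDiv (hv : ContDiff ℝ 1 v) (hdiv : MemLp (classicalDiv v) 2 (vol Ω)) :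
    HasWeakDiv Ω v (classicalDiv v) where
  memLp := hdiv
  weak φ hφ := by
    have hcomp (i : Fin d) : ContDiff ℝ 1 fun x => v x i := contDiff_euclidean.1 hv i
    have hleft (i : Fin d) :
        Integrable (fun x => partialDeriv i (fun y => v y i) x * φ x) (vol Ω) :=
      (hφ.integrable_mul (continuous_partialDeriv (hcomp i) i)).restrict
    have hright (i : Fin d) : Integrable (fun x => v x i * partialDeriv i φ x) (vol Ω) :=
      ((hφ.partialDeriv i).integrable_mul (hcomp i).continuous).restrict
    simp only [classicalDiv, Finset.sum_mul]
    rw [integral_finsetSum _ fun i _ => hleft i, integral_finsetSum _ fun i _ => hright i]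
    simp only [hφ.setIntegral_mul_partialDeriv (hcomp _), Finset.sum_neg_distrib, neg_neg]

theorem HasWeakDiv.mono (hw : HasWeakDiv Ω v w) (hU : U ⊆ Ω) : HasWeakDiv U v w where
  memLp := hw.memLp.mono_measure (Measure.restrict_mono_set _ hU)
  weak φ hφ := by
    have hzero : ∀ x ∉ tsupport φ, w x * φ x = 0 := fun x hx => by
      rw [image_eq_zero_of_notMem_tsupport hx, mul_zero]
    have hzero' : ∀ x ∉ tsupport φ, ∑ i, v x i * partialDeriv i φ x = 0 := fun x hx => by
      simp only [IsTestFunction.partialDeriv_eq_zero_of_notMem hx, mul_zero, Finset.sum_const_zero]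
    rw [hφ.setIntegral_eq_integral hzero, hφ.setIntegral_eq_integral hzero',
      ← (hφ.mono hU).setIntegral_eq_integral hzero, ← (hφ.mono hU).setIntegral_eq_integral hzero']
    exact hw.weak φ (hφ.mono hU)

theorem HasWeakDiv.congr (hw : HasWeakDiv U v w) (hU : MeasurableSet U) (hv : Set.EqOn v v' U) :
    HasWeakDiv U v' w where
  memLp := hw.memLp
  weak φ hφ := by
    rw [hw.weak φ hφ, neg_inj]
    exact setIntegral_congr_fun hU fun x hx => by simp only [hv hx]

theorem HasWeakDiv.ae_eq (hw : HasWeakDiv Ω v w) (hw' : HasWeakDiv Ω v w') (hΩ : IsOpen Ω) :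
    w =ᵐ[vol Ω] w' := by
  have hloc : LocallyIntegrableOn (w - w') Ω (vol Ω) :=
    ((hw.memLp.sub hw'.memLp).locallyIntegrable one_le_two).locallyIntegrableOn Ω
  have horth := hΩ.ae_eq_zero_of_integral_contDiff_smul_eq_zero hloc fun φ hφ hφc hφΩ => by
    have hφ : IsTestFunction Ω φ := ⟨hφ, hφc, hφΩ⟩
    have hint := hw.memLp.integrable_mul (hφ.memLp 2)
    have hint' := hw'.memLp.integrable_mul (hφ.memLp 2)
    calc ∫ x in Ω, φ x • (w - w') x = ∫ x in Ω, (w x * φ x - w' x * φ x) := by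
          simp only [Pi.sub_apply, smul_eq_mul, mul_sub, mul_comm]
      _ = (∫ x in Ω, w x * φ x) - ∫ x in Ω, w' x * φ x := integral_sub hint hint'
      _ = 0 := by rw [hw.weak φ hφ, hw'.weak φ hφ, sub_self]
  filter_upwards [horth, ae_restrict_mem hΩ.measurableSet] with x hx hxΩ
  exact sub_eq_zero.1 (hx hxΩ)

theorem MemHdiv.hasWeakDiv (hv : MemHdiv Ω v) : HasWeakDiv Ω v (weakDiv Ω v) := by
  rw [weakDiv, dif_pos hv.2]
  exact hv.2.choose_spec

theorem IsTestFunction.memH0div {φ : Rd d → Rd d} (hφ : IsTestFunction Ω φ) (hΩ : IsOpen Ω) :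
    MemH0div Ω φ := by
  have hdiv : HasWeakDiv Ω φ (classicalDiv φ) :=
    hasWeakDiv_classicalDiv (hφ.smooth.of_le (by simp)) (hφ.memLp_classicalDiv 2)
  have hmem : MemHdiv Ω φ := ⟨hφ.memLp 2, _, hdiv⟩
  have hzero : (fun x => weakDiv Ω φ x - classicalDiv φ x) =ᵐ[vol Ω] 0 :=
    (hmem.hasWeakDiv.ae_eq hdiv hΩ).mono fun x hx => sub_eq_zero.2 hx
  refine ⟨hmem, fun _ => φ, fun _ => hφ, by simp, ?_⟩
  simp [eLpNorm_congr_ae hzero]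

theorem IsH1WithGradient.setIntegral_inner_of_memH0div (hq : IsH1WithGradient Ω q f)
    (hv : MemH0div Ω v) : ∫ x in Ω, inner ℝ (f x) (v x) = -∫ x in Ω, q x * weakDiv Ω v x := by
  obtain ⟨hv, φ, hφ, hφv, hφdiv⟩ := hv
  have hlim := tendsto_integral_inner_of_tendsto_eLpNorm (𝕜 := ℝ) hq.memLp_gradient hv.1
    (fun n => (hφ n).memLp 2) hφv
  have hlimdiv := tendsto_integral_inner_of_tendsto_eLpNorm (𝕜 := ℝ) hq.memLp hv.hasWeakDiv.memLp
    (fun n => (hφ n).memLp_classicalDiv 2) hφdiv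
  simp only [RCLike.inner_apply, conj_trivial, mul_comm _ (q _)] at hlimdiv
  simp only [hq.setIntegral_inner_of_isTestFunction (hφ _)] at hlim
  exact tendsto_nhds_unique hlim hlimdiv.neg

theorem MemH0div.setIntegral_weakDiv [IsFiniteMeasure (vol Ω)] (hv : MemH0div Ω v) :
    ∫ x in Ω, weakDiv Ω v x = 0 := by
  simpa using (isH1WithGradient_const 1).setIntegral_inner_of_memH0div hv

end Weak

/-! ### Admissible potentials -/

/-- The constant `κ` that gives the hydrostatic density `π / c_M + κ` the total mass `M`. -/
noncomputable def densityShift (Ω : Set (Rd d)) (cM M : ℝ) (q : Rd d → ℝ) : ℝ :=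
  (M - (∫ x in Ω, q x) / cM) / volume.real Ω

section Admissible

variable {Ω : Set (Rd d)} [IsFiniteMeasure (vol Ω)] {cM M C : ℝ} {q : Rd d → ℝ}

theorem densityShift_eq (hvol : volume.real Ω ≠ 0) (hq : Integrable q (vol Ω))
    (hM : ∫ x in Ω, (q x - C) / cM = M) : densityShift Ω cM M q = -C / cM := by
  rw [integral_div, integral_sub hq (integrable_const C), setIntegral_const, smul_eq_mul] at hM
  rw [densityShift, div_eq_iff hvol, ← hM]
  ring

theorem IsAdmissiblePotential.ae_nonneg (hadm : IsAdmissiblePotential Ω cM M q)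
    (hvol : volume.real Ω ≠ 0) (hq : Integrable q (vol Ω)) :
    ∀ᵐ x ∂vol Ω, 0 ≤ q x / cM + densityShift Ω cM M q := by
  obtain ⟨C, hC, hM⟩ := hadm
  filter_upwards [hC] with x hx
  rwa [densityShift_eq hvol hq hM, neg_div, ← sub_eq_add_neg, ← sub_div]

end Admissible

namespace Triangulation

/-! ### The elements of a triangulation -/

section Cells

variable {Ω : Set (Rd d)} {𝒯 : Triangulation Ω}

theorem interior_hull_nonempty_iff {s : Finset (Rd d)}
    (hs : AffineIndependent ℝ ((↑) : s → Rd d)) :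
    (interior (hull s)).Nonempty ↔ s.card = d + 1 := by
  rw [interior_convexHull_nonempty_iff_affineSpan_eq_top]
  simpa using hs.affineSpan_eq_top_iff_card_eq_finrank_add_one

theorem isCompact_hull (s : Finset (Rd d)) : IsCompact (hull s) :=
  s.finite_toSet.isCompact_convexHull ℝ

theorem mem_cells {s : Finset (Rd d)} :
    s ∈ 𝒯.cells ↔ s ∈ 𝒯.complex.faces ∧ s.card = d + 1 := by
  rw [cells, Finset.mem_filter, Set.Finite.mem_toFinset]

theorem cell_mem_faces (T : 𝒯.cells) : T.1 ∈ 𝒯.complex.faces := (mem_cells.1 T.2).1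

theorem cell_card (T : 𝒯.cells) : T.1.card = d + 1 := (mem_cells.1 T.2).2

theorem isBounded (𝒯 : Triangulation Ω) : Bornology.IsBounded Ω := by
  have hspace : Bornology.IsBounded 𝒯.complex.space :=
    (Bornology.isBounded_biUnion 𝒯.finite).2 fun s _ => (isCompact_hull s).isBounded
  exact (𝒯.space_eq ▸ hspace).subset subset_closure

theorem isFiniteMeasure_vol (𝒯 : Triangulation Ω) : IsFiniteMeasure (vol Ω) :=
  ⟨by simpa using 𝒯.isBounded.measure_lt_top⟩

theorem volume_real_pos (𝒯 : Triangulation Ω) (hΩ : IsOpen Ω) (hne : Ω.Nonempty) :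
    0 < volume.real Ω :=
  ENNReal.toReal_pos (hΩ.measure_pos _ hne).ne' 𝒯.isBounded.measure_lt_top.ne

theorem volume_inter_interior_cell_ne_zero (hΩ : IsOpen Ω) (T : 𝒯.cells) :
    volume (Ω ∩ interior (hull T.1)) ≠ 0 := by
  have hne : (interior (hull T.1)).Nonempty :=
    (interior_hull_nonempty_iff (𝒯.complex.indep (cell_mem_faces T))).2 (cell_card T)
  have hsub : interior (hull T.1) ⊆ closure Ω := 𝒯.space_eq ▸
    interior_subset.trans (𝒯.complex.convexHull_subset_space (cell_mem_faces T))
  have hmeet : (closure Ω ∩ interior (hull T.1)).Nonempty :=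
    hne.mono fun x hx => ⟨hsub hx, hx⟩
  exact ((hΩ.inter isOpen_interior).measure_pos _
    ((closure_inter_open_nonempty_iff isOpen_interior).1 hmeet)).ne'

theorem disjoint_interior_cell {S T : 𝒯.cells} (hST : S ≠ T) :
    Disjoint (interior (hull S.1)) (interior (hull T.1)) := by
  classical
  have hsub : hull S.1 ∩ hull T.1 ⊆ hull (S.1 ∩ T.1) := by
    simpa only [← Finset.coe_inter] using
      𝒯.complex.inter_subset_convexHull (cell_mem_faces S) (cell_mem_faces T)
  have hindep : AffineIndependent ℝ ((↑) : ↥(S.1 ∩ T.1) → Rd d) :=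
    (𝒯.complex.indep (cell_mem_faces S)).mono (Finset.coe_subset.2 Finset.inter_subset_left)
  rw [Set.disjoint_iff_inter_eq_empty, ← interior_inter, ← Set.not_nonempty_iff_eq_empty]
  intro hne
  have hcard : (S.1 ∩ T.1).card = d + 1 :=
    (interior_hull_nonempty_iff hindep).1 (hne.mono (interior_mono hsub))
  have hS : S.1 ∩ T.1 = S.1 := Finset.eq_of_subset_of_card_le Finset.inter_subset_left
    (by rw [hcard, cell_card S])
  have hT : S.1 ∩ T.1 = T.1 := Finset.eq_of_subset_of_card_le Finset.inter_subset_right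
    (by rw [hcard, cell_card T])
  exact hST (Subtype.ext (hS.symm.trans hT))

theorem ae_exists_mem_interior_cell (𝒯 : Triangulation Ω) :
    ∀ᵐ x ∂(vol Ω), ∃ T : 𝒯.cells, x ∈ interior (hull T.1) := by
  have hnull : ∀ᵐ x : Rd d, ∀ T : 𝒯.cells, x ∉ frontier (hull T.1) :=
    ae_all_iff.2 fun T => measure_eq_zero_iff_ae_notMem.1
      ((convex_convexHull ℝ (T.1 : Set (Rd d))).addHaar_frontier volume)
  refine ae_restrict_of_ae_restrict_of_subset subset_closure ?_
  rw [ae_restrict_iff' isClosed_closure.measurableSet, ← 𝒯.space_eq]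
  filter_upwards [hnull] with x hx hxspace
  obtain ⟨s, hs, hxs⟩ := Geometry.SimplicialComplex.mem_space_iff.1 hxspace
  obtain ⟨t, ht, hst, hcard⟩ := 𝒯.pure s hs
  have hxt : x ∈ hull t := convexHull_mono (Finset.coe_subset.2 hst) hxs
  let T : 𝒯.cells := ⟨t, mem_cells.2 ⟨ht, hcard⟩⟩
  exact ⟨T, by_contra fun hxT => hx T ⟨subset_closure hxt, hxT⟩⟩

end Cells

/-! ### Piecewise polynomials -/

section PiecewisePolynomials

variable {Ω : Set (Rd d)} {𝒯 : Triangulation Ω}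

theorem sum_indicator_interior_cell {E : Type*} [AddCommMonoid E] (g : 𝒯.cells → Rd d → E)
    {T : 𝒯.cells} {x : Rd d} (hx : x ∈ interior (hull T.1)) :
    ∑ S : 𝒯.cells, (interior (hull S.1)).indicator (g S) x = g T x := by
  rw [Finset.sum_eq_single_of_mem T (Finset.mem_univ T), Set.indicator_of_mem hx]
  intro S _ hST
  exact Set.indicator_of_notMem
    (fun hxS => Set.disjoint_left.1 (disjoint_interior_cell hST) hxS hx) _

theorem Scalar.toFun_of_mem (r : 𝒯.Scalar) {T : 𝒯.cells} {x : Rd d}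
    (hx : x ∈ interior (hull T.1)) : Scalar.toFun r x = pval (r T) x :=
  sum_indicator_interior_cell (fun T => pval (r T)) hx

theorem Vector.toFun_of_mem (v : 𝒯.Vector) {T : 𝒯.cells} {x : Rd d}
    (hx : x ∈ interior (hull T.1)) : Vector.toFun v x = vval (v T) x :=
  sum_indicator_interior_cell (fun T => vval (v T)) hx

theorem Vector.toFun_zero : Vector.toFun (0 : 𝒯.Vector) = 0 := by
  ext x
  simp [Vector.toFun, vval_zero]

theorem Scalar.toFun_single_one [DecidableEq 𝒯.cells] (T : 𝒯.cells) :
    Scalar.toFun (Pi.single T 1 : 𝒯.Scalar) = (interior (hull T.1)).indicator 1 := by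
  ext x
  rw [Scalar.toFun, Finset.sum_eq_single_of_mem T (Finset.mem_univ T)]
  · have hone : pval (1 : Poly d) = 1 := by ext y; simp [pval]
    rw [Pi.single_eq_same, hone]
  · intro S _ hST
    simp [pval, hST]

theorem memLp_restrict_hull {E : Type*} [NormedAddCommGroup E] {g : Rd d → E}
    (hg : Continuous g) (s : Finset (Rd d)) (p : ℝ≥0∞) : MemLp g p (vol (hull s)) := by
  have : IsFiniteMeasure (vol (hull s)) :=
    ⟨by simpa using (isCompact_hull s).measure_lt_top⟩
  obtain ⟨C, hC⟩ := (isCompact_hull s).exists_bound_of_continuousOn hg.continuousOn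
  exact MemLp.of_bound hg.aestronglyMeasurable C
    (ae_restrict_of_forall_mem (isCompact_hull s).measurableSet hC)

theorem Scalar.memLp_toFun (r : 𝒯.Scalar) (p : ℝ≥0∞) : MemLp (Scalar.toFun r) p (vol Ω) :=
  memLp_finsetSum _ fun T _ => MemLp.restrict _ <|
    (memLp_indicator_iff_restrict isOpen_interior.measurableSet).2 <|
      (memLp_restrict_hull (contDiff_pval (n := 0) (r T)).continuous T.1 p).mono_measure
        (Measure.restrict_mono_set _ interior_subset)

/-- Evaluation of piecewise polynomials on `Ω` as a linear map, for use with the general projection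
theorem in `L²`. -/
noncomputable def Scalar.toFunₗ (𝒯 : Triangulation Ω) : 𝒯.Scalar →ₗ[ℝ] Rd d → ℝ where
  toFun := Scalar.toFun
  map_add' r s := by
    ext x
    simp only [Scalar.toFun, Pi.add_apply, ← Finset.sum_add_distrib]
    refine Finset.sum_congr rfl fun T _ => ?_
    by_cases hx : x ∈ interior (hull T.1) <;> simp [hx, pval]
  map_smul' c r := by
    ext x
    simp only [Scalar.toFun, Pi.smul_apply, Finset.smul_sum, RingHom.id_apply]
    refine Finset.sum_congr rfl fun T _ => ?_
    by_cases hx : x ∈ interior (hull T.1) <;> simp [hx, pval, MvPolynomial.smul_eval]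

/-- The piecewise divergence of a piecewise polynomial vector field. On `V_h` it represents the weak
divergence. -/
noncomputable def Vector.piecewiseDiv (v : 𝒯.Vector) : 𝒯.Scalar :=
  fun T => ∑ i, MvPolynomial.pderiv i (v T i)

theorem Vector.piecewiseDiv_mem_Qh {k : ℕ} {v : 𝒯.Vector} (hv : v ∈ 𝒯.Vh k) :
    Vector.piecewiseDiv v ∈ 𝒯.Qh k :=
  fun T => MvPolynomial.totalDegree_finsetSum_le fun i _ =>
    (totalDegree_pderiv_le i _).trans (Nat.sub_le_sub_right (hv.1 T i) 1)

theorem Vector.weakDiv_toFun_ae_eq (hΩ : IsOpen Ω) {v : 𝒯.Vector}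
    (hv : MemHdiv Ω (Vector.toFun v)) :
    weakDiv Ω (Vector.toFun v) =ᵐ[vol Ω] Scalar.toFun (Vector.piecewiseDiv v) := by
  have hcell (T : 𝒯.cells) : ∀ᵐ x ∂vol Ω, x ∈ interior (hull T.1) →
      weakDiv Ω (Vector.toFun v) x = classicalDiv (vval (v T)) x := by
    have hU : IsOpen (Ω ∩ interior (hull T.1)) := hΩ.inter isOpen_interior
    have hdiv : Continuous (classicalDiv (vval (v T))) := continuous_finsetSum _ fun i _ =>
      continuous_partialDeriv (contDiff_pval (v T i)) i
    have hpoly : HasWeakDiv (Ω ∩ interior (hull T.1)) (vval (v T)) (classicalDiv (vval (v T))) :=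
      hasWeakDiv_classicalDiv (contDiff_vval (v T)) <|
        (memLp_restrict_hull hdiv T.1 2).mono_measure
          (Measure.restrict_mono_set _ (Set.inter_subset_right.trans interior_subset))
    have hweak := (hv.hasWeakDiv.mono (U := Ω ∩ interior (hull T.1)) Set.inter_subset_left).congr
      hU.measurableSet fun x hx => Vector.toFun_of_mem v hx.2
    rw [← ae_restrict_iff' isOpen_interior.measurableSet,
      Measure.restrict_restrict isOpen_interior.measurableSet, Set.inter_comm]
    exact hweak.ae_eq hpoly hU
  filter_upwards [ae_all_iff.2 hcell, 𝒯.ae_exists_mem_interior_cell] with x hx ⟨T, hT⟩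
  rw [hx T hT, classicalDiv_vval, Scalar.toFun_of_mem _ hT, Vector.piecewiseDiv]

end PiecewisePolynomials

/-! ### The projection onto the density space -/

section Projection

variable {Ω : Set (Rd d)} {𝒯 : Triangulation Ω} {k : ℕ} {q : Rd d → ℝ} {π : 𝒯.Scalar}

theorem exists_isL2Projection (𝒯 : Triangulation Ω) (k : ℕ) (hq : MemLp q 2 (vol Ω)) :
    ∃ π : 𝒯.Scalar, 𝒯.IsL2Projection k q π := by
  let ι := (MvPolynomial.restrictTotalDegree (Fin d) ℝ (k - 1)).subtype.compLeft 𝒯.cells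
  obtain ⟨π, hπ⟩ := exists_forall_integral_inner_sub_eq_zero (𝕜 := ℝ) (Scalar.toFunₗ 𝒯 ∘ₗ ι)
    (fun r => Scalar.memLp_toFun (ι r) 2) hq
  refine ⟨ι π, fun T => (MvPolynomial.mem_restrictTotalDegree _ _ _).1 (π T).2, fun r hr => ?_⟩
  have hπr := hπ fun T => ⟨r T, (MvPolynomial.mem_restrictTotalDegree _ _ _).2 (hr T)⟩
  simp only [RCLike.inner_apply, conj_trivial, mul_comm _ (q _ - _)] at hπr
  exact hπr

namespace IsL2Projection

theorem setIntegral_mul (hπ : 𝒯.IsL2Projection k q π) (hq : MemLp q 2 (vol Ω)) {r : 𝒯.Scalar}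
    (hr : r ∈ 𝒯.Qh k) :
    ∫ x in Ω, Scalar.toFun π x * Scalar.toFun r x = ∫ x in Ω, q x * Scalar.toFun r x := by
  have hqr : Integrable (fun x => q x * Scalar.toFun r x) (vol Ω) :=
    hq.integrable_mul (Scalar.memLp_toFun r 2)
  have hπr : Integrable (fun x => Scalar.toFun π x * Scalar.toFun r x) (vol Ω) :=
    (Scalar.memLp_toFun π 2).integrable_mul (Scalar.memLp_toFun r 2)
  have horth := hπ.2 r hr
  simp only [sub_mul] at horth
  rw [integral_sub hqr hπr] at horth
  exact (sub_eq_zero.1 horth).symm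

theorem setIntegral_mul_weakDiv (hπ : 𝒯.IsL2Projection k q π) (hΩ : IsOpen Ω)
    (hq : MemLp q 2 (vol Ω)) {v : 𝒯.Vector} (hv : v ∈ 𝒯.Vh k) :
    ∫ x in Ω, Scalar.toFun π x * weakDiv Ω (Vector.toFun v) x
      = ∫ x in Ω, q x * weakDiv Ω (Vector.toFun v) x := by
  have hdiv (g : Rd d → ℝ) : ∫ x in Ω, g x * weakDiv Ω (Vector.toFun v) x
      = ∫ x in Ω, g x * Scalar.toFun (Vector.piecewiseDiv v) x :=
    integral_congr_ae <| (Vector.weakDiv_toFun_ae_eq hΩ hv.2.1).mono fun x hx => by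
      simp only [hx]
  rw [hdiv, hdiv, hπ.setIntegral_mul hq (Vector.piecewiseDiv_mem_Qh hv)]

theorem setIntegral_cell (hπ : 𝒯.IsL2Projection k q π) (hq : MemLp q 2 (vol Ω)) (T : 𝒯.cells) :
    ∫ x in Ω ∩ interior (hull T.1), pval (π T) x = ∫ x in Ω ∩ interior (hull T.1), q x := by
  classical
  have hT : MeasurableSet (interior (hull T.1)) := isOpen_interior.measurableSet
  have hmem : (Pi.single T 1 : 𝒯.Scalar) ∈ 𝒯.Qh k := fun S => by
    by_cases hS : S = T
    · subst hS; simp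
    · simp [hS]
  have hindicator (g : Rd d → ℝ) : ∫ x in Ω, g x * Scalar.toFun (Pi.single T 1 : 𝒯.Scalar) x
      = ∫ x in Ω ∩ interior (hull T.1), g x := by
    rw [← setIntegral_indicator hT, Scalar.toFun_single_one]
    simp only [Set.indicator_apply, Pi.one_apply, mul_ite, mul_one, mul_zero]
  have horth := hπ.setIntegral_mul hq hmem
  rw [hindicator, hindicator] at horth
  rw [← horth]
  refine integral_congr_ae (ae_restrict_of_ae_restrict_of_subset Set.inter_subset_right ?_)
  filter_upwards [ae_restrict_mem hT] with x hx
  rw [Scalar.toFun_of_mem _ hx]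

theorem setIntegral (hπ : 𝒯.IsL2Projection k q π) (hq : MemLp q 2 (vol Ω)) :
    ∫ x in Ω, Scalar.toFun π x = ∫ x in Ω, q x := by
  have hone : ∀ᵐ x ∂vol Ω, Scalar.toFun (1 : 𝒯.Scalar) x = 1 := by
    filter_upwards [𝒯.ae_exists_mem_interior_cell] with x ⟨T, hT⟩
    simp [Scalar.toFun_of_mem _ hT, pval]
  have hmul (g : Rd d → ℝ) : ∫ x in Ω, g x * Scalar.toFun (1 : 𝒯.Scalar) x = ∫ x in Ω, g x :=
    integral_congr_ae <| hone.mono fun x hx => by simp only [hx, mul_one]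
  rw [← hmul, ← hmul q, hπ.setIntegral_mul hq fun T => by simp]

theorem pval_eq_setAverage (hπ : 𝒯.IsL2Projection 1 q π) (hΩ : IsOpen Ω) (hq : MemLp q 2 (vol Ω))
    (T : 𝒯.cells) (x : Rd d) : pval (π T) x = ⨍ y in Ω ∩ interior (hull T.1), q y := by
  obtain ⟨c, hc⟩ : ∃ c, π T = MvPolynomial.C c :=
    ⟨_, MvPolynomial.totalDegree_eq_zero_iff_eq_C.1 (Nat.le_zero.1 (hπ.1 T))⟩
  have hval : pval (π T) = fun _ => c := by ext y; simp [hc, pval]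
  have hvol : volume (Ω ∩ interior (hull T.1)) ≠ ⊤ :=
    (𝒯.isBounded.subset Set.inter_subset_left).measure_lt_top.ne
  rw [setAverage_eq, ← hπ.setIntegral_cell hq T, ← setAverage_eq, hval,
    setAverage_const (volume_inter_interior_cell_ne_zero hΩ T) hvol]

end IsL2Projection

end Projection

/-! ### The hydrostatic solution -/

section Hydrostatic

variable {Ω : Set (Rd d)} {𝒯 : Triangulation Ω} {k : ℕ} {cM κ M : ℝ} {q : Rd d → ℝ}
  {f : Rd d → Rd d} {π : 𝒯.Scalar}

theorem pval_hydrostaticDensity (cM κ : ℝ) (π : 𝒯.Scalar) (T : 𝒯.cells) (x : Rd d) :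
    pval (hydrostaticDensity cM κ π T) x = pval (π T) x / cM + κ := by
  simp [hydrostaticDensity, pval, div_eq_inv_mul]

theorem toFun_hydrostaticDensity_ae_eq (cM κ : ℝ) (π : 𝒯.Scalar) :
    ∀ᵐ x ∂vol Ω, Scalar.toFun (hydrostaticDensity cM κ π) x = Scalar.toFun π x / cM + κ := by
  filter_upwards [𝒯.ae_exists_mem_interior_cell] with x ⟨T, hT⟩
  rw [Scalar.toFun_of_mem _ hT, Scalar.toFun_of_mem _ hT, pval_hydrostaticDensity]

theorem hydrostaticDensity_mem_Qh (cM κ : ℝ) (hπ : π ∈ 𝒯.Qh k) :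
    hydrostaticDensity cM κ π ∈ 𝒯.Qh k := fun T => by
  rw [hydrostaticDensity, ← MvPolynomial.smul_eq_C_mul]
  exact (MvPolynomial.totalDegree_add _ _).trans
    (max_le ((MvPolynomial.totalDegree_smul_le _ _).trans (hπ T)) (by simp))

theorem zero_mem_Vh (𝒯 : Triangulation Ω) (k : ℕ) (hΩ : IsOpen Ω) : (0 : 𝒯.Vector) ∈ 𝒯.Vh k :=
  ⟨fun T i => by simp, by
    rw [Vector.toFun_zero]
    exact (IsTestFunction.zero Ω).memH0div hΩ⟩

theorem zero_mem_VhHat (𝒯 : Triangulation Ω) (k : ℕ) : (0 : 𝒯.FacetVector) ∈ 𝒯.VhHat k :=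
  ⟨fun F i => by simp, fun F n _ x _ => by simp [vval_zero], fun F _ x _ => by simp [vval_zero]⟩

theorem aForm_zero (k : ℕ) (ν α : ℝ) (v : 𝒯.Vector) (vhat : 𝒯.FacetVector) :
    𝒯.aForm k ν α 0 0 v vhat = 0 := by
  have hgradInner (w : Fin d → Poly d) (x : Rd d) : gradInner 0 w x = 0 := by
    simp [gradInner, pval]
  have hgradMul (n x : Rd d) : gradMul (0 : Fin d → Poly d) n x = 0 := by
    ext i; simp [gradMul, pval]
  have hjump (T : 𝒯.cells) (F : 𝒯.facets) (x : Rd d) : 𝒯.tangJump 0 0 T F x = 0 := by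
    simp [tangJump, tangential, vval_zero]
  simp [aForm, bdryIntegral, hgradInner, hgradMul, hjump]

theorem cForm_zero (r l : 𝒯.Scalar) : 𝒯.cForm r 0 l = 0 := by
  simp [cForm, bdryIntegral, vval_zero]

theorem gForm_zero (r : 𝒯.Scalar) (v : 𝒯.Vector) : 𝒯.gForm 0 r v = 0 := by
  simp [gForm]

theorem bForm_hydrostaticDensity (hΩ : IsOpen Ω) (hcM : cM ≠ 0) (κ : ℝ)
    (hq : IsH1WithGradient Ω q f) (hπ : 𝒯.IsL2Projection k q π) {v : 𝒯.Vector}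
    (hv : v ∈ 𝒯.Vh k) : 𝒯.bForm cM (hydrostaticDensity cM κ π) v = 𝒯.fForm f v := by
  have := 𝒯.isFiniteMeasure_vol
  set w := weakDiv Ω (Vector.toFun v)
  have hw : MemLp w 2 (vol Ω) := hv.2.1.hasWeakDiv.memLp
  have hπw : Integrable (fun x => Scalar.toFun π x * w x) (vol Ω) :=
    (Scalar.memLp_toFun π 2).integrable_mul hw
  have hκw : Integrable (fun x => cM * κ * w x) (vol Ω) :=
    (hw.integrable one_le_two).const_mul _
  calc 𝒯.bForm cM (hydrostaticDensity cM κ π) v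
      = -∫ x in Ω, (Scalar.toFun π x * w x + cM * κ * w x) := by
        rw [bForm, integral_congr_ae]
        filter_upwards [toFun_hydrostaticDensity_ae_eq cM κ π] with x hx
        rw [hx, mul_add, mul_div_cancel₀ _ hcM, add_mul]
    _ = -∫ x in Ω, Scalar.toFun π x * w x := by
        rw [integral_add hπw hκw, integral_const_mul, hv.2.setIntegral_weakDiv, mul_zero, add_zero]
    _ = -∫ x in Ω, q x * w x := by rw [hπ.setIntegral_mul_weakDiv hΩ hq.memLp hv]
    _ = 𝒯.fForm f v := (hq.setIntegral_inner_of_memH0div hv.2).symm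

theorem setIntegral_hydrostaticDensity (hΩ : IsOpen Ω) (hne : Ω.Nonempty) (cM M : ℝ)
    (hq : MemLp q 2 (vol Ω)) (hπ : 𝒯.IsL2Projection k q π) :
    ∫ x in Ω, Scalar.toFun (hydrostaticDensity cM (densityShift Ω cM M q) π) x = M := by
  have := 𝒯.isFiniteMeasure_vol
  have hπ_int : Integrable (Scalar.toFun π) (vol Ω) :=
    (Scalar.memLp_toFun π 2).integrable one_le_two
  rw [integral_congr_ae (toFun_hydrostaticDensity_ae_eq cM _ π),
    integral_add (hπ_int.div_const cM) (integrable_const _), integral_div, hπ.setIntegral hq,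
    setIntegral_const, smul_eq_mul, densityShift, mul_div_cancel₀ _ (𝒯.volume_real_pos hΩ hne).ne',
    add_sub_cancel]

theorem isDiscreteSolution_hydrostaticDensity (hΩ : IsOpen Ω) (hne : Ω.Nonempty) (ν α M : ℝ)
    (hcM : cM ≠ 0) (hq : IsH1WithGradient Ω q f) (hπ : 𝒯.IsL2Projection k q π) :
    𝒯.IsDiscreteSolution k ν α cM M 0 f 0 0
      (hydrostaticDensity cM (densityShift Ω cM M q) π) where
  velocity_mem := 𝒯.zero_mem_Vh k hΩ
  hybrid_mem := 𝒯.zero_mem_VhHat k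
  density_mem := hydrostaticDensity_mem_Qh _ _ hπ.1
  momentum v hv vhat _ := by
    rw [aForm_zero, gForm_zero, zero_add, add_zero, bForm_hydrostaticDensity hΩ hcM _ hq hπ hv]
  continuity l _ := cForm_zero _ l
  mass := setIntegral_hydrostaticDensity hΩ hne cM M hq.memLp hπ

/-! ### The sign of the density for `k = 1` -/

theorem exists_le_pval_hydrostaticDensity (hΩ : IsOpen Ω) (cM κ : ℝ) (hq : MemLp q 2 (vol Ω))
    (hπ : 𝒯.IsL2Projection 1 q π) {P : Rd d → Prop} (hP : ∀ᵐ x ∂vol Ω, P x) (T : 𝒯.cells)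
    (x : Rd d) : ∃ y, P y ∧ q y / cM + κ ≤ pval (hydrostaticDensity cM κ π T) x := by
  have := 𝒯.isFiniteMeasure_vol
  set U := Ω ∩ interior (hull T.1)
  have hle_vol : vol U ≤ vol Ω := Measure.restrict_mono_set _ Set.inter_subset_left
  have : IsFiniteMeasure (vol U) := isFiniteMeasure_of_le _ hle_vol
  have : NeZero (vol U) :=
    ⟨mt Measure.restrict_eq_zero.1 (volume_inter_interior_cell_ne_zero hΩ T)⟩
  have hq_int : Integrable q (vol U) := (hq.mono_measure hle_vol).integrable one_le_two
  have havg : pval (hydrostaticDensity cM κ π T) x = ⨍ y in U, (q y / cM + κ) := by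
    rw [pval_hydrostaticDensity, hπ.pval_eq_setAverage hΩ hq, average_div_add_const hq_int]
  obtain ⟨y, hy, hle⟩ := exists_notMem_null_le_average (NeZero.ne (vol U))
    ((hq_int.div_const cM).add (integrable_const κ))
    (ae_iff.1 (ae_restrict_of_ae_restrict_of_subset Set.inter_subset_left hP))
  exact ⟨y, not_not.1 hy, havg ▸ hle⟩

theorem hydrostaticDensity_nonneg (hΩ : IsOpen Ω) (hq : MemLp q 2 (vol Ω))
    (hπ : 𝒯.IsL2Projection 1 q π) (hnonneg : ∀ᵐ x ∂vol Ω, 0 ≤ q x / cM + κ) (T : 𝒯.cells)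
    (x : Rd d) : 0 ≤ pval (hydrostaticDensity cM κ π T) x :=
  have ⟨_, hy, hle⟩ := exists_le_pval_hydrostaticDensity hΩ cM κ hq hπ hnonneg T x
  hy.trans hle

theorem hydrostaticDensity_pos (hΩ : IsOpen Ω) (hq : MemLp q 2 (vol Ω))
    (hπ : 𝒯.IsL2Projection 1 q π) (hpos : ∀ᵐ x ∂vol Ω, 0 < q x / cM + κ) (T : 𝒯.cells)
    (x : Rd d) : 0 < pval (hydrostaticDensity cM κ π T) x :=
  have ⟨_, hy, hle⟩ := exists_le_pval_hydrostaticDensity hΩ cM κ hq hπ hpos T x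
  hy.trans_le hle

end Hydrostatic

end Triangulation

end CompressibleStokes

open CompressibleStokes Triangulation in
theorem mainTheorem3_general {d : ℕ} {Ω : Set (Rd d)} (hΩ : IsOpen Ω) (hne : Ω.Nonempty)
    (𝒯 : Triangulation Ω) {k : ℕ} (hk : 1 ≤ k) (ν α M : ℝ) {cM : ℝ} (hcM : cM ≠ 0) :
    𝒯.GradientRobust k ν α cM M ∧
    ∀ (q : Rd d → ℝ) (f : Rd d → Rd d), IsH1WithGradient Ω q f →
      ∃ (π : 𝒯.Scalar) (κ : ℝ),
        𝒯.IsL2Projection k q π ∧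
        κ = (M - (∫ x in Ω, q x) / cM) / volume.real Ω ∧
        𝒯.IsDiscreteSolution k ν α cM M 0 f 0 0 (hydrostaticDensity cM κ π) ∧
        (k = 1 → IsAdmissiblePotential Ω cM M q → ∀ T, ∀ x ∈ hull T.1,
          0 ≤ pval (hydrostaticDensity cM κ π T) x) ∧
        (k = 1 → (∀ᵐ x ∂vol Ω, 0 < q x / cM + κ) → ∀ T, ∀ x ∈ hull T.1,
          0 < pval (hydrostaticDensity cM κ π T) x) := by
  have := 𝒯.isFiniteMeasure_vol
  refine ⟨fun f ⟨q, hq, _⟩ => ?_, fun q f hq => ?_⟩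
  · obtain ⟨π, hπ⟩ := 𝒯.exists_isL2Projection k hq.memLp
    exact ⟨_, isDiscreteSolution_hydrostaticDensity hΩ hne ν α M hcM hq hπ⟩
  · obtain ⟨π, hπ⟩ := 𝒯.exists_isL2Projection k hq.memLp
    refine ⟨π, densityShift Ω cM M q, hπ, rfl,
      isDiscreteSolution_hydrostaticDensity hΩ hne ν α M hcM hq hπ, ?_, ?_⟩
    · rintro rfl hadm T x -
      exact hydrostaticDensity_nonneg hΩ hq.memLp hπ
        (hadm.ae_nonneg (𝒯.volume_real_pos hΩ hne).ne' (hq.memLp.integrable one_le_two)) T x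
    · rintro rfl hpos T x -
      exact hydrostaticDensity_pos hΩ hq.memLp hπ hpos T x

theorem mainTheorem3 {d : ℕ} (hd : d = 2 ∨ d = 3)
    (Ω : Set (CompressibleStokes.Rd d)) (hΩ : CompressibleStokes.IsLipschitzDomain Ω)
    (𝒯 : CompressibleStokes.Triangulation Ω) (k : ℕ) (hk : 1 ≤ k)
    (ν α cM M : ℝ) (hν : 0 < ν) (hα : 0 < α) (hcM : 0 < cM) (hM : 0 < M) :
    𝒯.GradientRobust k ν α cM M ∧
    ∀ (q : CompressibleStokes.Rd d → ℝ)
      (f : CompressibleStokes.Rd d → CompressibleStokes.Rd d),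
      CompressibleStokes.IsH1WithGradient Ω q f →
      CompressibleStokes.IsAdmissiblePotential Ω cM M q →
      ∃ (π : 𝒯.Scalar) (κ : ℝ),
        𝒯.IsL2Projection k q π ∧
        κ = (M - (∫ x in Ω, q x) / cM) / MeasureTheory.volume.real Ω ∧
        𝒯.IsDiscreteSolution k ν α cM M 0 f 0 0
          (CompressibleStokes.Triangulation.hydrostaticDensity cM κ π) ∧
        (k = 1 → ∀ T, ∀ x ∈ CompressibleStokes.hull T.1,
          0 ≤ CompressibleStokes.pval
            (CompressibleStokes.Triangulation.hydrostaticDensity cM κ π T) x) ∧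
        (k = 1 → (∀ᵐ x ∂(CompressibleStokes.vol Ω), 0 < q x / cM + κ) →
          ∀ T, ∀ x ∈ CompressibleStokes.hull T.1,
            0 < CompressibleStokes.pval
              (CompressibleStokes.Triangulation.hydrostaticDensity cM κ π T) x) := by
  obtain ⟨hrobust, hsol⟩ :=
    mainTheorem3_general hΩ.isOpen hΩ.isConnected.nonempty 𝒯 hk ν α M hcM.ne'
  refine ⟨hrobust, fun q f hq hadm => ?_⟩
  obtain ⟨π, κ, hπ, hκ, hsolves, hnonneg, hpos⟩ := hsol q f hq
  exact ⟨π, κ, hπ, hκ, hsolves, fun hk1 => hnonneg hk1 hadm, hpos⟩
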